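/- Let $\mu:\mathbb R\to\mathbb R$ be a smooth $2\pi$-periodic function (a mass-aspect function, i.e. a smooth function on $S^1=\mathbb R/2\pi\mathbb Z$). A Hill function of $\mu$ is a solution $\psi:\mathbb R\to\mathbb R$, not identically zero, of $\psi''=\frac{\mu}{4}\psi$. We say that $\mu$ can be transformed to $\nu$ if there is a smooth $f:\mathbb R\to\mathbb R$ with $f'>0$ and $f(x+2\pi)=f(x)+2\pi$ (the lift of an orientation-preserving diffeomorphism of $S^1$) such that $$\nu=(f')^2\,\mu\circ f-2S(f),\qquad S(f)=\frac{f'''}{f'}-\frac32\Big(\frac{f''}{f'}\Big)^2 .$$ The function $\mu$ is said to be - of type $\mathcal E_{m_c}$, where $m_c<0$, if it can be transformed to the constant $m_c$; - of type $\mathcal H_0$ if it can be transformed to some positive constant, and of type $\mathcal P_0$ if it can be transformed to $0$; - of type $\mathcal H_n$, $n\ge1$, if for some $\sigma>0$ it can be transformed to $\sigma+2\frac{n^2+\sigma}{F}-3\frac{n^2}{F^2}$, where $F(x)=\cos^2\frac{nx}{2}+\big(\sin\frac{nx}{2}+\frac{\sqrt\sigma}{n}\cos\frac{nx}{2}\big)^2$;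 - of type $\mathcal P_n^q$, $n\ge1$, $q=\pm1$, if it can be transformed to $\frac{2n^2}{J}-\frac{3n^2(1+\frac{q}{2\pi})}{J^2}$, where $J(x)=1+\frac{q}{2\pi}\sin^2\frac{nx}{2}$. Let $I\subset\mathbb R$ be a half-closed interval of length $2\pi$, i.e. $I=[a,a+2\pi)$ or $I=(a,a+2\pi]$ for some $a\in\mathbb R$. Then: 1. If $\mu$ is of type $\mathcal H_n$ with $n\ge1$, or of type $\mathcal P_n^q$ with $n\ge1$, $q=\pm1$, then every Hill function of $\mu$ has $n-1$, $n$ or $n+1$ zeros on $I$. 2. If $\mu$ is of type $\mathcal E_{m_c}$, then every Hill function of $\mu$ has either $\lfloor\sqrt{|m_c|}\rfloor$ or $\lfloor\sqrt{|m_c|}\rfloor+1$ zeros on $I$, and precisely $\sqrt{|m_c|}$ zeros when $\sqrt{|m_c|}\in\mathbb N$. 3. If $\mu$ is of type $\mathcal H_0$ or $\mathcal P_0$, then every Hill function of $\mu$ has either one zero or no zeros on $I$. -/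

import Mathlib

noncomputable section

/-- A mass-aspect function: a smooth real function on the circle `ℝ / 2πℤ`, viewed as a smooth
`2π`-periodic function on `ℝ`. -/
def IsMassAspect (μ : ℝ → ℝ) : Prop :=
  ContDiff ℝ ((⊤ : ℕ∞) : WithTop ℕ∞) μ ∧ Function.Periodic μ (2 * Real.pi)

/-- A Hill function of `μ`: a nontrivial solution of `ψ'' = (μ / 4) ψ` on `ℝ`. -/
def IsHillFunction (μ ψ : ℝ → ℝ) : Prop :=
  ContDiff ℝ 2 ψ ∧ (∀ x, deriv (deriv ψ) x = μ x / 4 * ψ x) ∧ ∃ x, ψ x ≠ 0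

/-- The lift to `ℝ` of an orientation-preserving diffeomorphism of the circle `ℝ / 2πℤ`. -/
def IsCircleDiffeoLift (f : ℝ → ℝ) : Prop :=
  ContDiff ℝ ((⊤ : ℕ∞) : WithTop ℕ∞) f ∧ (∀ x, 0 < deriv f x) ∧
    ∀ x, f (x + 2 * Real.pi) = f x + 2 * Real.pi

/-- The Schwarzian derivative. -/
def schwarzian (f : ℝ → ℝ) (x : ℝ) : ℝ :=
  iteratedDeriv 3 f x / deriv f x - 3 / 2 * (iteratedDeriv 2 f x / deriv f x) ^ 2

/-- The action of an asymptotic symmetry `f` on a mass-aspect function. -/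
def transformedMassAspect (μ f : ℝ → ℝ) (x : ℝ) : ℝ :=
  deriv f x ^ 2 * μ (f x) - 2 * schwarzian f x

/-- `μ` can be transformed to `ν` by an asymptotic symmetry. -/
def TransformsTo (μ ν : ℝ → ℝ) : Prop :=
  ∃ f : ℝ → ℝ, IsCircleDiffeoLift f ∧ ∀ x, transformedMassAspect μ f x = ν x

/-- The function `F` entering the canonical hyperbolic mass-aspect functions. -/
def hypF (n : ℕ) (σ x : ℝ) : ℝ :=
  Real.cos (n * x / 2) ^ 2 +
    (Real.sin (n * x / 2) + Real.sqrt σ / n * Real.cos (n * x / 2)) ^ 2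

/-- The canonical hyperbolic mass-aspect function with parameters `n ≥ 1`, `σ > 0`. -/
def hypMassAspect (n : ℕ) (σ x : ℝ) : ℝ :=
  σ + 2 * (((n : ℝ) ^ 2 + σ) / hypF n σ x) - 3 * ((n : ℝ) ^ 2 / hypF n σ x ^ 2)

/-- The function `J` entering the canonical parabolic mass-aspect functions. -/
def parJ (n : ℕ) (q x : ℝ) : ℝ :=
  1 + q / (2 * Real.pi) * Real.sin (n * x / 2) ^ 2

/-- The canonical parabolic mass-aspect function with parameters `n ≥ 1`, `q = ± 1`. -/
def parMassAspect (n : ℕ) (q x : ℝ) : ℝ :=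
  2 * (n : ℝ) ^ 2 / parJ n q x -
    3 * (n : ℝ) ^ 2 * (1 + q / (2 * Real.pi)) / parJ n q x ^ 2

/-- Type `E_m`, for a negative constant `m`. -/
def IsTypeE (m : ℝ) (μ : ℝ → ℝ) : Prop :=
  m < 0 ∧ TransformsTo μ (fun _ => m)

/-- Type `H_0`. -/
def IsTypeHZero (μ : ℝ → ℝ) : Prop :=
  ∃ m : ℝ, 0 < m ∧ TransformsTo μ (fun _ => m)

/-- Type `H_n`, for `n ≥ 1`. -/
def IsTypeH (n : ℕ) (μ : ℝ → ℝ) : Prop :=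
  1 ≤ n ∧ ∃ σ : ℝ, 0 < σ ∧ TransformsTo μ (hypMassAspect n σ)

/-- Type `P_0`. -/
def IsTypePZero (μ : ℝ → ℝ) : Prop :=
  TransformsTo μ (fun _ => 0)

/-- Type `P_n^q`, for `n ≥ 1` and `q = ± 1`. -/
def IsTypeP (n : ℕ) (q : ℝ) (μ : ℝ → ℝ) : Prop :=
  1 ≤ n ∧ (q = 1 ∨ q = -1) ∧ TransformsTo μ (parMassAspect n q)

/-- A half-closed interval of length `2π`: closed on exactly one side. -/
def IsHalfClosedPeriodInterval (I : Set ℝ) : Prop :=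
  ∃ a : ℝ, I = Set.Ico a (a + 2 * Real.pi) ∨ I = Set.Ioc a (a + 2 * Real.pi)

/-- The number of zeros of `ψ` on `I` (`⊤` if there are infinitely many). -/
def numZeros (ψ : ℝ → ℝ) (I : Set ℝ) : ℕ∞ :=
  {x ∈ I | ψ x = 0}.encard

end

/-! If `f` transforms `μ` into `ν`, then `ψ ∘ f / √f'` solves Hill's equation for `ν` whenever `ψ`
solves it for `μ`. The Schwarzian term is exactly what makes this hold. Since `f` permutes the
half-closed intervals of length `2π` by preimage, zero counts survive
(`TransformsTo.exists_hillSolution`), and only the canonical `ν` matter.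

By Sturm separation the zero counts of two nontrivial solutions on an interval differ by at most one
(`HillSolution.numZeros_le`), so one explicit solution suffices. For `H_n` and `P_n^q` it is a
nonvanishing factor times a shifted `sin (n x / 2)`, with exactly `n` zeros; for `H_0` and `P_0` it
is an exponential or a constant, with none. For type `E` every solution is a shifted sine, so its
zeros are counted directly. -/

/-! ### Uniqueness and Sturm separation -/

/-- `v` is a solution of `v'' = q v` with derivative `v'`. -/
def HillSolution (q v v' : ℝ → ℝ) : Prop :=
  (∀ x, HasDerivAt v (v' x) x) ∧ ∀ x, HasDerivAt v' (q x * v x) x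

theorem HillSolution.continuous {q v v' : ℝ → ℝ} (h : HillSolution q v v') : Continuous v :=
  continuous_iff_continuousAt.2 fun x => (h.1 x).continuousAt

/-- A solution vanishing to second order at a point vanishes identically. -/
theorem HillSolution.eq_zero {q v v' : ℝ → ℝ} (hq : Continuous q) (h : HillSolution q v v')
    {t₀ : ℝ} (h0 : v t₀ = 0) (h1 : v' t₀ = 0) (t : ℝ) : v t = 0 := by
  obtain ⟨A, B, ht, ht₀⟩ : ∃ A B, t ∈ Set.Ioo A B ∧ t₀ ∈ Set.Ioo A B :=
    ⟨min t t₀ - 1, max t t₀ + 1, by grind, by grind⟩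
  obtain ⟨C, hC⟩ := (isCompact_Icc (a := A) (b := B)).exists_bound_of_continuousOn hq.continuousOn
  -- The system is `(v, v')' = (v', q v)`: the first component has Lipschitz constant `1`, the
  -- second a local bound for `|q|`.
  set K : NNReal := max 1 (Real.toNNReal C) with hK
  have hK1 : (1 : ℝ) ≤ K := by
    have : (1 : NNReal) ≤ K := le_max_left _ _
    exact_mod_cast this
  have hKC : C ≤ K := by
    have : Real.toNNReal C ≤ K := le_max_right _ _
    exact (Real.le_coe_toNNReal C).trans (by exact_mod_cast this)
  have key := ODE_solution_unique_of_mem_Ioo (E := ℝ × ℝ) (a := A) (b := B) (t₀ := t₀) (K := K)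
    (v := fun t p => (p.2, q t * p.1)) (s := fun _ => Set.univ)
    (f := fun t => (v t, v' t)) (g := fun _ => (0, 0)) ?_ ht₀ ?_ ?_ ?_
  · exact congrArg Prod.fst (key ht)
  · intro s hs
    refine (LipschitzWith.of_dist_le_mul fun x y => ?_).lipschitzOnWith
    have hqs : |q s| ≤ K := (hC s ⟨hs.1.le, hs.2.le⟩).trans hKC
    rw [Prod.dist_eq, Prod.dist_eq]
    have hm := le_max_left (dist x.1 y.1) (dist x.2 y.2)
    have hm' := le_max_right (dist x.1 y.1) (dist x.2 y.2)
    have hm0 : 0 ≤ max (dist x.1 y.1) (dist x.2 y.2) := dist_nonneg.trans hm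
    refine max_le ?_ ?_
    · exact hm'.trans (le_mul_of_one_le_left hm0 hK1)
    · simp only [Real.dist_eq] at *
      rw [← mul_sub, abs_mul]
      exact mul_le_mul hqs hm (abs_nonneg _) (by positivity)
  · exact fun s _ => ⟨(h.1 s).prodMk (h.2 s), trivial⟩
  · intro s _
    refine ⟨?_, trivial⟩
    exact (hasDerivAt_const s ((0 : ℝ), (0 : ℝ))).congr_deriv
      (Prod.ext rfl (mul_zero _).symm)
  · simp [h0, h1]

/-- The Wronskian of two solutions is constant. -/
theorem HillSolution.wronskian {q u u' v v' : ℝ → ℝ} (hu : HillSolution q u u')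
    (hv : HillSolution q v v') (x y : ℝ) :
    u x * v' x - u' x * v x = u y * v' y - u' y * v y := by
  have hd : ∀ x, HasDerivAt (fun x => u x * v' x - u' x * v x) 0 x := fun x => by
    refine (((hu.1 x).mul (hv.2 x)).sub ((hu.2 x).mul (hv.1 x))).congr_deriv ?_
    ring
  exact is_const_of_deriv_eq_zero (fun x => (hd x).differentiableAt) (fun x => (hd x).deriv) x y

/-- Sturm separation for solutions with non-vanishing Wronskian. -/
theorem HillSolution.exists_zero_between {q u u' v v' : ℝ → ℝ} (hu : HillSolution q u u')
    (hv : HillSolution q v v') (hW : ∀ x, u x * v' x - u' x * v x ≠ 0) {x y : ℝ} (hxy : x < y)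
    (hx : u x = 0) (hy : u y = 0) : ∃ z ∈ Set.Ioo x y, v z = 0 := by
  by_contra! hne
  have hne' : ∀ z ∈ Set.Icc x y, v z ≠ 0 := by
    intro z hz hvz
    rcases hz.1.eq_or_lt with rfl | h1
    · exact hW x (by rw [hx, hvz]; ring)
    rcases hz.2.eq_or_lt with rfl | h2
    · exact hW z (by rw [hy, hvz]; ring)
    exact hne z ⟨h1, h2⟩ hvz
  -- Rolle applied to `u / v`, whose derivative is minus the Wronskian over `v ^ 2`.
  obtain ⟨c, hc, hd⟩ := exists_hasDerivAt_eq_zero (f := fun z => u z / v z)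
    (f' := fun z => (u' z * v z - u z * v' z) / v z ^ 2) hxy
    (fun z hz => ((hu.continuous.continuousAt).div hv.continuous.continuousAt
      (hne' z hz)).continuousWithinAt) (by simp [hx, hy])
    (fun z hz => (hu.1 z).div (hv.1 z) (hne' z (Set.Ioo_subset_Icc_self hz)))
  have hc' := hne' c (Set.Ioo_subset_Icc_self hc)
  rw [div_eq_zero_iff] at hd
  rcases hd with hd | hd
  · exact hW c (by linarith)
  · exact hc' (by simpa using hd)

/-- On an interval, a nontrivial solution has at most one zero more than any other solution. -/
theorem HillSolution.numZeros_le {q u u' v v' : ℝ → ℝ} (hq : Continuous q)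
    (hu : HillSolution q u u') (hu0 : ∃ x, u x ≠ 0) (hv : HillSolution q v v')
    {I : Set ℝ} (hI : I.OrdConnected) : numZeros u I ≤ numZeros v I + 1 := by
  unfold numZeros
  by_cases hW : ∀ x, u x * v' x - u' x * v x ≠ 0
  · rcases Set.finite_or_infinite {x ∈ I | v x = 0} with hf | hf
    · rw [hf.encard_eq_coe_toFinset_card]
      -- Finite subsets are bounded first, because the zero set of `u` is not yet known to be
      -- finite.
      have hfin : ∀ s : Finset ℝ, (s : Set ℝ) ⊆ {x ∈ I | u x = 0} →
          s.card ≤ hf.toFinset.card + 1 := by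
        intro s hs
        refine Finset.card_le_of_interleaved fun x hx y hy hxy _ => ?_
        obtain ⟨z, hz, hvz⟩ := hu.exists_zero_between hv hW hxy (hs hx).2 (hs hy).2
        exact ⟨z, by simpa using ⟨hI.out (hs hx).1 (hs hy).1 ⟨hz.1.le, hz.2.le⟩, hvz⟩, hz⟩
      by_contra! hlt
      have hle := Order.add_one_le_of_lt hlt
      obtain ⟨t, ht, htc⟩ := Set.exists_subset_encard_eq hle
      have htf : t.Finite := Set.finite_of_encard_eq_coe (k := hf.toFinset.card + 1 + 1)
        (by rw [htc]; push_cast; rfl)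
      have h1 := hfin htf.toFinset (by simpa using ht)
      rw [htf.encard_eq_coe_toFinset_card] at htc
      have h2 : htf.toFinset.card = hf.toFinset.card + 1 + 1 := by exact_mod_cast htc
      omega
    · rw [hf.encard_eq]; simp
  -- The Wronskian now vanishes everywhere; at a zero of `u` it equals `-u' v` with `u' ≠ 0`.
  · push Not at hW
    obtain ⟨x₀, hx₀⟩ := hW
    suffices hsub : {x ∈ I | u x = 0} ⊆ {x ∈ I | v x = 0} from
      (Set.encard_le_encard hsub).trans le_self_add
    refine fun x hx => ⟨hx.1, ?_⟩
    have hw := hu.wronskian hv x x₀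
    rw [hx₀, hx.2] at hw
    have hprod : u' x * v x = 0 := by linarith
    rcases mul_eq_zero.1 hprod with h | h
    · obtain ⟨y, hy⟩ := hu0
      exact absurd (hu.eq_zero hq hx.2 h y) hy
    · exact h

/-! ### Division by a square root, and the zeros of a sine -/

/-- A criterion for `w / √F` to be a solution. -/
theorem hillSolution_div_sqrt {q w w' w'' F F' F'' : ℝ → ℝ}
    (hw : ∀ x, HasDerivAt w (w' x) x) (hw' : ∀ x, HasDerivAt w' (w'' x) x)
    (hF : ∀ x, HasDerivAt F (F' x) x) (hF' : ∀ x, HasDerivAt F' (F'' x) x)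
    (hpos : ∀ x, 0 < F x)
    (h : ∀ x, w'' x * F x ^ 2 - w' x * F' x * F x +
      w x * (3 / 4 * F' x ^ 2 - F'' x * F x / 2) = q x * F x ^ 2 * w x) :
    HillSolution q (fun x => w x / √(F x))
      (fun x => (w' x * F x - w x * F' x / 2) / (F x * √(F x))) := by
  have hs : ∀ x, HasDerivAt (fun x => √(F x)) (F' x / (2 * √(F x))) x :=
    fun x => (hF x).sqrt (hpos x).ne'
  have hsp : ∀ x, 0 < √(F x) := fun x => Real.sqrt_pos.2 (hpos x)
  have hsq : ∀ x, √(F x) ^ 2 = F x := fun x => Real.sq_sqrt (hpos x).le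
  refine ⟨fun x => ?_, fun x => ?_⟩
  · refine ((hw x).div (hs x) (hsp x).ne').congr_deriv ?_
    have h1 := hsp x
    have h2 := hsq x
    have h3 := hpos x
    beta_reduce
    generalize √(F x) = r at *
    rw [← h2]
    field_simp
  · refine ((((hw' x).mul (hF x)).sub (((hw x).mul (hF' x)).div_const 2)).div
      ((hF x).mul (hs x)) (mul_pos (hpos x) (hsp x)).ne').congr_deriv ?_
    have h1 := hsp x
    have h2 := hsq x
    have h4 := h x
    simp only [Pi.mul_apply, Pi.sub_apply]
    generalize √(F x) = r at *
    rw [← h2] at h4 ⊢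
    field_simp
    linear_combination 4 * h4

/-- Zeros of `sin (k (x - x₀) / 2)` on a half-closed interval of length `2π`. -/
theorem exists_numZeros_sin {k : ℝ} (hk : 0 < k) (x₀ : ℝ) {I : Set ℝ}
    (hI : IsHalfClosedPeriodInterval I) :
    ∃ M : ℕ, numZeros (fun x => Real.sin (k * (x - x₀) / 2)) I = M ∧ (M : ℝ) < k + 1 ∧
      k < M + 1 := by
  have hpi := Real.pi_pos
  have hinj : Function.Injective fun j : ℤ => x₀ + 2 * Real.pi * j / k := by
    intro i j hij
    have : (i : ℝ) = j := by
      have h : x₀ + 2 * Real.pi * i / k = x₀ + 2 * Real.pi * j / k := hij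
      field_simp at h
      nlinarith
    exact_mod_cast this
  have hzero : ∀ x, Real.sin (k * (x - x₀) / 2) = 0 ↔ ∃ j : ℤ, x₀ + 2 * Real.pi * j / k = x := by
    intro x
    rw [Real.sin_eq_zero_iff]
    refine exists_congr fun j => ?_
    constructor
    · intro h
      field_simp
      linarith
    · rintro rfl
      field_simp
      ring
  obtain ⟨a, hI⟩ := hI
  -- In the coordinate where the zeros are the integers, `I` runs from `α` to `α + k`.
  set α : ℝ := k * (a - x₀) / (2 * Real.pi) with hα
  have hlo : ∀ j : ℤ, x₀ + 2 * Real.pi * j / k - a = 2 * Real.pi / k * (j - α) := by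
    intro j
    rw [hα]
    field_simp
    ring
  have hhi : ∀ j : ℤ, a + 2 * Real.pi - (x₀ + 2 * Real.pi * j / k) =
      2 * Real.pi / k * (α + k - j) := by
    intro j
    rw [hα]
    field_simp
    ring
  have hc : 0 < 2 * Real.pi / k := by positivity
  have hcount : ∀ S : Finset ℤ, (∀ j : ℤ, j ∈ S ↔ x₀ + 2 * Real.pi * j / k ∈ I) →
      numZeros (fun x => Real.sin (k * (x - x₀) / 2)) I = S.card := by
    intro S hS
    have : {x ∈ I | Real.sin (k * (x - x₀) / 2) = 0} =
        (fun j : ℤ => x₀ + 2 * Real.pi * j / k) '' (S : Set ℤ) := by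
      ext x
      simp only [Set.mem_ofPred_eq, hzero, Set.mem_image, Finset.mem_coe, hS]
      constructor
      · rintro ⟨hx, j, rfl⟩
        exact ⟨j, hx, rfl⟩
      · rintro ⟨j, hx, rfl⟩
        exact ⟨hx, j, rfl⟩
    rw [numZeros, this, hinj.encard_image, Set.encard_coe_eq_coe_finsetCard]
  rcases hI with rfl | rfl
  · refine ⟨_, hcount (Finset.Ico ⌈α⌉ ⌈α + k⌉) fun j => ?_, ?_⟩
    · rw [Finset.mem_Ico, Int.ceil_le, Int.lt_ceil, Set.mem_Ico, ← sub_nonneg (b := a),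
        ← sub_pos (a := a + 2 * Real.pi), hlo, hhi, mul_nonneg_iff_of_pos_left hc,
        mul_pos_iff_of_pos_left hc, sub_nonneg, sub_pos]
    · have h0 : ⌈α⌉ ≤ ⌈α + k⌉ := Int.ceil_mono (by linarith)
      have h1 : ((Finset.Ico ⌈α⌉ ⌈α + k⌉).card : ℝ) = ⌈α + k⌉ - ⌈α⌉ := by
        rw [Int.card_Ico]
        exact_mod_cast Int.toNat_of_nonneg (sub_nonneg.2 h0)
      have := Int.le_ceil α
      have := Int.le_ceil (α + k)
      have := Int.ceil_lt_add_one α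
      have := Int.ceil_lt_add_one (α + k)
      rw [h1]
      constructor <;> linarith
  · refine ⟨_, hcount (Finset.Ioc ⌊α⌋ ⌊α + k⌋) fun j => ?_, ?_⟩
    · rw [Finset.mem_Ioc, Int.le_floor, Int.floor_lt, Set.mem_Ioc, ← sub_pos (b := a),
        ← sub_nonneg (a := a + 2 * Real.pi), hlo, hhi, mul_pos_iff_of_pos_left hc,
        mul_nonneg_iff_of_pos_left hc, sub_pos, sub_nonneg]
    · have h0 : ⌊α⌋ ≤ ⌊α + k⌋ := Int.floor_mono (by linarith)
      have h1 : ((Finset.Ioc ⌊α⌋ ⌊α + k⌋).card : ℝ) = ⌊α + k⌋ - ⌊α⌋ := by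
        rw [Int.card_Ioc]
        exact_mod_cast Int.toNat_of_nonneg (sub_nonneg.2 h0)
      have := Int.floor_le α
      have := Int.floor_le (α + k)
      have := Int.lt_floor_add_one α
      have := Int.lt_floor_add_one (α + k)
      rw [h1]
      constructor <;> linarith

/-! ### Transport of solutions by circle diffeomorphisms -/

theorem IsCircleDiffeoLift.surjective {f : ℝ → ℝ} (hf : IsCircleDiffeoLift f) :
    Function.Surjective f := by
  have hshift : ∀ n : ℕ, f (n * (2 * Real.pi)) = f 0 + n * (2 * Real.pi) := by
    intro n
    induction n with
    | zero => simp
    | succ n ih =>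
      have := hf.2.2 (n * (2 * Real.pi))
      rw [ih] at this
      push_cast
      rw [add_mul, one_mul, this]
      ring
  have hshift' : ∀ n : ℕ, f (-(n * (2 * Real.pi))) = f 0 - n * (2 * Real.pi) := by
    intro n
    induction n with
    | zero => simp
    | succ n ih =>
      have := hf.2.2 (-((n + 1 : ℕ) * (2 * Real.pi)))
      push_cast at this ⊢
      rw [show -(((n : ℝ) + 1) * (2 * Real.pi)) + 2 * Real.pi = -(n * (2 * Real.pi)) by ring,
        ih] at this
      linarith
  intro y
  have hpi : (0 : ℝ) < 2 * Real.pi := by positivity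
  obtain ⟨n, hn⟩ := exists_nat_ge (|y - f 0| / (2 * Real.pi))
  rw [div_le_iff₀ hpi] at hn
  have h1 := neg_abs_le (y - f 0)
  have h2 := le_abs_self (y - f 0)
  exact mem_range_of_exists_le_of_exists_ge hf.1.continuous
    ⟨-(n * (2 * Real.pi)), by rw [hshift']; linarith⟩ ⟨n * (2 * Real.pi), by rw [hshift]; linarith⟩

/-- The preimage of a half-closed interval of length `2π` is again one. -/
theorem IsCircleDiffeoLift.preimage {f : ℝ → ℝ} (hf : IsCircleDiffeoLift f) {I : Set ℝ}
    (hI : IsHalfClosedPeriodInterval I) : IsHalfClosedPeriodInterval (f ⁻¹' I) := by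
  have hm : StrictMono f := strictMono_of_deriv_pos hf.2.1
  obtain ⟨a, hI⟩ := hI
  obtain ⟨b, rfl⟩ := hf.surjective a
  refine ⟨b, ?_⟩
  rw [← hf.2.2 b] at hI
  rcases hI with rfl | rfl
  · left
    ext x
    simp [hm.le_iff_le, hm.lt_iff_lt]
  · right
    ext x
    simp [hm.le_iff_le, hm.lt_iff_lt]

/-- Hill functions of `μ` correspond to solutions of the transformed equation, with the same
number of zeros on half-closed intervals of length `2π`. -/
theorem TransformsTo.exists_hillSolution {μ ν ψ : ℝ → ℝ} (h : TransformsTo μ ν)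
    (hψ : IsHillFunction μ ψ) {I : Set ℝ} (hI : IsHalfClosedPeriodInterval I) :
    ∃ (φ φ' : ℝ → ℝ) (J : Set ℝ), HillSolution (fun x => ν x / 4) φ φ' ∧ (∃ x, φ x ≠ 0) ∧
      IsHalfClosedPeriodInterval J ∧ numZeros ψ I = numZeros φ J := by
  obtain ⟨f, hf, hν⟩ := h
  obtain ⟨hψ2, hψe, y, hy⟩ := hψ
  have hf0 : ∀ x, HasDerivAt f (deriv f x) x := fun x =>
    (hf.1.differentiable (by simp)).differentiableAt.hasDerivAt
  have hfi : ∀ n x, HasDerivAt (iteratedDeriv n f) (iteratedDeriv (n + 1) f x) x := fun n x => by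
    rw [iteratedDeriv_succ]
    exact (hf.1.differentiable_iteratedDeriv n
      (by exact_mod_cast WithTop.coe_lt_top _)).differentiableAt.hasDerivAt
  have hf1 : ∀ x, HasDerivAt (deriv f) (iteratedDeriv 2 f x) x := fun x => by
    simpa [iteratedDeriv_one] using hfi 1 x
  have hψ0 : ∀ x, HasDerivAt ψ (deriv ψ x) x := fun x =>
    (hψ2.differentiable (by simp)).differentiableAt.hasDerivAt
  have hψ1 : ∀ x, HasDerivAt (deriv ψ) (μ x / 4 * ψ x) x := fun x => by
    rw [← hψe]
    have : ContDiff ℝ 1 (deriv ψ) := ((contDiff_succ_iff_deriv (n := 1)).1 hψ2).2.2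
    exact (this.differentiable (by simp)).differentiableAt.hasDerivAt
  -- Here `w = ψ ∘ f` and `F = f'`.
  have hsol := hillSolution_div_sqrt (q := fun x => ν x / 4)
    (fun x => (hψ0 (f x)).comp x (hf0 x))
    (fun x => ((hψ1 (f x)).comp x (hf0 x)).mul (hf1 x)) hf1 (hfi 2) hf.2.1 (fun x => by
      have hp := hf.2.1 x
      rw [← hν x, transformedMassAspect, schwarzian]
      simp only [Function.comp_apply]
      field_simp
      ring)
  refine ⟨_, _, f ⁻¹' I, hsol, ?_, hf.preimage hI, ?_⟩
  · obtain ⟨x, rfl⟩ := hf.surjective y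
    exact ⟨x, div_ne_zero hy (Real.sqrt_pos.2 (hf.2.1 x)).ne'⟩
  · have hm : StrictMono f := strictMono_of_deriv_pos hf.2.1
    rw [numZeros, numZeros,
      ← hm.injective.encard_image {x ∈ f ⁻¹' I | (ψ ∘ f) x / √(deriv f x) = 0}]
    congr 1
    ext y
    obtain ⟨x, rfl⟩ := hf.surjective y
    simp [hm.injective.eq_iff, (Real.sqrt_pos.2 (hf.2.1 _)).ne']

/-! ### Zero counts from one explicit solution -/

theorem IsHalfClosedPeriodInterval.ordConnected {I : Set ℝ}
    (hI : IsHalfClosedPeriodInterval I) : I.OrdConnected := by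
  obtain ⟨a, rfl | rfl⟩ := hI
  · exact Set.ordConnected_Ico
  · exact Set.ordConnected_Ioc

/-- Comparison of the zeros of Hill functions with those of an explicit solution of the
transformed equation. -/
theorem TransformsTo.numZeros_le {μ ν ψ u u' : ℝ → ℝ} (h : TransformsTo μ ν)
    (hν : Continuous ν) (hψ : IsHillFunction μ ψ) {I : Set ℝ} (hI : IsHalfClosedPeriodInterval I)
    (hu : HillSolution (fun x => ν x / 4) u u') (hu0 : ∃ x, u x ≠ 0) :
    ∃ J, IsHalfClosedPeriodInterval J ∧ numZeros ψ I ≤ numZeros u J + 1 ∧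
      numZeros u J ≤ numZeros ψ I + 1 := by
  obtain ⟨φ, φ', J, hφ, hφ0, hJ, hz⟩ := h.exists_hillSolution hψ hI
  have hq : Continuous fun x => ν x / 4 := hν.div_const 4
  refine ⟨J, hJ, ?_, ?_⟩ <;> rw [hz]
  · exact hφ.numZeros_le hq hφ0 hu hJ.ordConnected
  · exact hu.numZeros_le hq hu0 hφ hJ.ordConnected

/-- If the transformed equation has a solution with the zeros of `sin (n (x - x₀) / 2)`, then
Hill functions have `n - 1`, `n` or `n + 1` zeros. -/
theorem TransformsTo.numZeros_of_sin_factor {μ ν ψ g u' : ℝ → ℝ} {n : ℕ} (hn : 1 ≤ n) {x₀ : ℝ}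
    (h : TransformsTo μ ν) (hν : Continuous ν) (hψ : IsHillFunction μ ψ) {I : Set ℝ}
    (hI : IsHalfClosedPeriodInterval I) (hg : ∀ x, g x ≠ 0)
    (hu : HillSolution (fun x => ν x / 4) (fun x => g x * Real.sin (n * (x - x₀) / 2)) u') :
    numZeros ψ I + 1 = (n : ℕ∞) ∨ numZeros ψ I = (n : ℕ∞) ∨ numZeros ψ I = (n : ℕ∞) + 1 := by
  have hn0 : (0 : ℝ) < n := by exact_mod_cast hn
  obtain ⟨J, hJ, h1, h2⟩ := h.numZeros_le hν hψ hI hu ⟨x₀ + Real.pi / n, by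
    have : (n : ℝ) * (x₀ + Real.pi / n - x₀) / 2 = Real.pi / 2 := by
      field_simp
      ring
    rw [this, Real.sin_pi_div_two, mul_one]
    exact hg _⟩
  obtain ⟨M, hM, hM1, hM2⟩ := exists_numZeros_sin hn0 x₀ hJ
  -- Two integers at distance less than one are equal.
  have hMn : M = n := by
    have h3 : M < n + 1 := by exact_mod_cast hM1
    have h4 : n < M + 1 := by exact_mod_cast hM2
    omega
  have hz : numZeros (fun x => g x * Real.sin (n * (x - x₀) / 2)) J = n := by
    rw [← hMn, ← hM, hMn]
    simp [numZeros, hg]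
  rw [hz] at h1 h2
  generalize numZeros ψ I = z at *
  have hz : z ≠ ⊤ := ne_top_of_le_ne_top (by exact_mod_cast ENat.natCast_ne_top (n + 1)) h1
  lift z to ℕ using hz
  norm_cast at *
  omega

theorem TransformsTo.numZeros_of_pos {μ ν ψ u u' : ℝ → ℝ}
    (h : TransformsTo μ ν) (hν : Continuous ν) (hψ : IsHillFunction μ ψ) {I : Set ℝ}
    (hI : IsHalfClosedPeriodInterval I) (hpos : ∀ x, 0 < u x)
    (hu : HillSolution (fun x => ν x / 4) u u') :
    numZeros ψ I = 0 ∨ numZeros ψ I = 1 := by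
  obtain ⟨J, hJ, h1, -⟩ := h.numZeros_le hν hψ hI hu ⟨0, (hpos 0).ne'⟩
  have hz : numZeros u J = 0 := by
    simp [numZeros, (hpos _).ne']
  rw [hz, zero_add] at h1
  exact Order.le_one_iff.1 h1

/-! ### Explicit solutions for the canonical mass-aspect functions -/

theorem hypF_pos (n : ℕ) (σ x : ℝ) : 0 < hypF n σ x := by
  unfold hypF
  by_cases hc : Real.cos (n * x / 2) = 0
  · have := Real.sin_sq_add_cos_sq (n * x / 2)
    rw [hc] at this ⊢
    nlinarith
  · positivity

theorem parJ_pos (n : ℕ) {q : ℝ} (hq : q = 1 ∨ q = -1) (x : ℝ) : 0 < parJ n q x := by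
  have hpi := Real.pi_gt_three
  have h1 := Real.sin_sq_le_one (n * x / 2)
  have h2 := sq_nonneg (Real.sin (n * x / 2))
  -- Any lower bound above `-1` would do.
  have h3 : -(1 / 2) ≤ q / (2 * Real.pi) := by
    rw [le_div_iff₀ (by positivity)]
    rcases hq with rfl | rfl <;> linarith
  unfold parJ
  nlinarith

theorem continuous_hypMassAspect (n : ℕ) (σ : ℝ) : Continuous (hypMassAspect n σ) := by
  have hF : Continuous (hypF n σ) := by
    unfold hypF
    fun_prop
  have h0 : ∀ x, hypF n σ x ≠ 0 := fun x => (hypF_pos n σ x).ne'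
  unfold hypMassAspect
  fun_prop (disch := simp [h0])

theorem continuous_parMassAspect (n : ℕ) {q : ℝ} (hq : q = 1 ∨ q = -1) :
    Continuous (parMassAspect n q) := by
  have hF : Continuous (parJ n q) := by
    unfold parJ
    fun_prop
  have h0 : ∀ x, parJ n q x ≠ 0 := fun x => (parJ_pos n hq x).ne'
  unfold parMassAspect
  fun_prop (disch := simp [h0])

theorem hasDerivAt_sin_half (n x : ℝ) :
    HasDerivAt (fun x => Real.sin (n * x / 2)) (n / 2 * Real.cos (n * x / 2)) x := by
  refine (((hasDerivAt_id x).const_mul n).div_const 2).sin.congr_deriv ?_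
  simp only [id_eq]
  ring

theorem hasDerivAt_cos_half (n x : ℝ) :
    HasDerivAt (fun x => Real.cos (n * x / 2)) (-(n / 2) * Real.sin (n * x / 2)) x := by
  refine (((hasDerivAt_id x).const_mul n).div_const 2).cos.congr_deriv ?_
  simp only [id_eq]
  ring

theorem hasDerivAt_exp_mul (b x : ℝ) :
    HasDerivAt (fun x => Real.exp (b * x)) (b * Real.exp (b * x)) x := by
  refine ((hasDerivAt_id x).const_mul b).exp.congr_deriv ?_
  simp only [id_eq]
  ring

/-- A periodic solution for the canonical parabolic mass-aspect functions. -/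
theorem exists_hillSolution_par (n : ℕ) {q : ℝ} (hq : q = 1 ∨ q = -1) :
    ∃ u', HillSolution (fun x => parMassAspect n q x / 4)
      (fun x => Real.sin (n * x / 2) / √(parJ n q x)) u' := by
  set p := q / (2 * Real.pi) with hp
  have hs := hasDerivAt_sin_half n
  have hc := hasDerivAt_cos_half n
  refine ⟨_, hillSolution_div_sqrt (F := parJ n q) hs (fun x => (hc x).const_mul _)
    (F' := fun x => n * p * (Real.sin (n * x / 2) * Real.cos (n * x / 2)))
    (fun x => ?_) (fun x => ((hs x).mul (hc x)).const_mul _) (parJ_pos n hq) fun x => ?_⟩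
  · refine ((((hs x).pow 2).const_mul p).const_add 1).congr_deriv ?_
    simp only [Nat.cast_ofNat, Nat.add_one_sub_one, pow_one]
    ring
  · have h0 := parJ_pos n hq x
    have hsc := Real.sin_sq_add_cos_sq (n * x / 2)
    have hJ : parJ n q x = Real.cos (n * x / 2) ^ 2 + (1 + p) * Real.sin (n * x / 2) ^ 2 := by
      rw [parJ, ← hp]
      linear_combination -hsc
    have hν : parMassAspect n q x / 4 * parJ n q x ^ 2 =
        (2 * n ^ 2 * parJ n q x - 3 * n ^ 2 * (1 + p)) / 4 := by
      rw [parMassAspect, ← hp]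
      field_simp
    rw [hν, hJ]
    generalize Real.sin (n * x / 2) = s at *
    generalize Real.cos (n * x / 2) = c at *
    linear_combination (s / 4 * (2 * n ^ 2 * (c ^ 2 + (1 + p) * s ^ 2) -
      3 * n ^ 2 * (1 + p) * (s ^ 2 + c ^ 2 + 1))) * hsc

/-- A solution for the canonical hyperbolic mass-aspect functions. -/
theorem exists_hillSolution_hyp {n : ℕ} (hn : 1 ≤ n) {σ : ℝ} (hσ : 0 < σ) :
    ∃ u', HillSolution (fun x => hypMassAspect n σ x / 4)
      (fun x => Real.exp (-(√σ / 2) * x) * Real.cos (n * x / 2) / √(hypF n σ x)) u' := by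
  have hn0 : (0 : ℝ) < n := by exact_mod_cast hn
  -- Writing `√σ = n β` makes the identity to check polynomial in `n`, `β`, sine and cosine, up to
  -- the exponential factor.
  set β := √σ / n with hβ
  have hσβ : √σ = n * β := by rw [hβ]; field_simp
  have hσ2 : σ = (n * β) ^ 2 := by rw [← hσβ, Real.sq_sqrt hσ.le]
  have hs := hasDerivAt_sin_half n
  have hc := hasDerivAt_cos_half n
  have he := hasDerivAt_exp_mul (-(√σ / 2))
  have hr := fun x => (hs x).add ((hc x).const_mul β)
  refine ⟨_, hillSolution_div_sqrt (F := hypF n σ) (fun x => (he x).mul (hc x))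
    (fun x => (((he x).const_mul _).mul (hc x)).add ((he x).mul ((hs x).const_mul _)))
    (F' := fun x => n * (Real.cos (n * x / 2) * -Real.sin (n * x / 2) +
      (Real.sin (n * x / 2) + β * Real.cos (n * x / 2)) *
        (Real.cos (n * x / 2) - β * Real.sin (n * x / 2))))
    (fun x => (((hc x).pow 2).add ((hr x).pow 2)).congr_deriv ?_)
    (fun x => (((hc x).mul (hs x).neg).add
      ((hr x).mul ((hc x).sub ((hs x).const_mul β)))).const_mul _) (hypF_pos n σ) fun x => ?_⟩
  · simp only [Nat.cast_ofNat, Nat.add_one_sub_one, pow_one, Pi.add_apply]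
    ring
  · have h0 := hypF_pos n σ x
    have hF : hypF n σ x = Real.cos (n * x / 2) ^ 2 +
      (Real.sin (n * x / 2) + β * Real.cos (n * x / 2)) ^ 2 := rfl
    have hsc := Real.sin_sq_add_cos_sq (n * x / 2)
    have hν : hypMassAspect n σ x / 4 * hypF n σ x ^ 2 =
        (σ * hypF n σ x ^ 2 + 2 * (n ^ 2 + σ) * hypF n σ x - 3 * n ^ 2) / 4 := by
      rw [hypMassAspect]
      field_simp
    rw [hν, hF]
    simp only [Pi.add_apply, Pi.sub_apply, Pi.neg_apply]
    clear_value β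
    generalize Real.exp (-(√σ / 2) * x) = e
    rw [hσβ, hσ2]
    generalize Real.sin (n * x / 2) = s at *
    generalize Real.cos (n * x / 2) = c at *
    linear_combination (e * c / 4 * (2 * (n ^ 2 + (n * β) ^ 2) * (c ^ 2 + (s + β * c) ^ 2) -
      3 * n ^ 2 * (s ^ 2 + c ^ 2 + 1))) * hsc

/-- Solutions of the equation with a negative constant are sinusoidal. -/
theorem HillSolution.eq_sin {k : ℝ} (hk : 0 < k) {v v' : ℝ → ℝ}
    (hv : HillSolution (fun _ => -k ^ 2 / 4) v v') (hv0 : ∃ x, v x ≠ 0) :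
    ∃ R x₀, R ≠ 0 ∧ ∀ x, v x = R * Real.sin (k * (x - x₀) / 2) := by
  have hs := hasDerivAt_sin_half k
  have hc := hasDerivAt_cos_half k
  have hS : HillSolution (fun _ => -k ^ 2 / 4) (fun x => Real.sin (k * x / 2))
      (fun x => k / 2 * Real.cos (k * x / 2)) :=
    ⟨hs, fun x => by exact ((hc x).const_mul (k / 2)).congr_deriv (by ring)⟩
  have hC : HillSolution (fun _ => -k ^ 2 / 4) (fun x => Real.cos (k * x / 2))
      (fun x => -(k / 2) * Real.sin (k * x / 2)) :=
    ⟨hc, fun x => by exact ((hs x).const_mul (-(k / 2))).congr_deriv (by ring)⟩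
  -- The modulus and argument of `z` give the amplitude and phase.
  set z : ℂ := ⟨v 0, 2 / k * v' 0⟩ with hz
  have hform : ∀ x, v x = v 0 * Real.cos (k * x / 2) + 2 / k * v' 0 * Real.sin (k * x / 2) := by
    intro x
    have h1 := hS.wronskian hv x 0
    have h2 := hC.wronskian hv x 0
    have h3 := Real.sin_sq_add_cos_sq (k * x / 2)
    simp only [mul_zero, zero_div, Real.sin_zero, Real.cos_zero] at h1 h2
    field_simp
    -- Constancy of the Wronskians with sine and cosine gives a linear system for `v x` and `v' x`;
    -- `v' x` is eliminated.
    linear_combination (-2 * Real.cos (k * x / 2)) * h1 + 2 * Real.sin (k * x / 2) * h2 - k * v x * h3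
  have hre : ‖z‖ * Real.cos z.arg = v 0 := Complex.norm_mul_cos_arg z
  have him : ‖z‖ * Real.sin z.arg = 2 / k * v' 0 := Complex.norm_mul_sin_arg z
  have hfin : ∀ x, v x = ‖z‖ * Real.sin (k * (x - (2 * z.arg - Real.pi) / k) / 2) := by
    intro x
    have : k * (x - (2 * z.arg - Real.pi) / k) / 2 = k * x / 2 - z.arg + Real.pi / 2 := by
      field_simp
      ring
    rw [this, Real.sin_add_pi_div_two, Real.cos_sub, hform x, ← hre, ← him]
    ring
  refine ⟨‖z‖, (2 * z.arg - Real.pi) / k, fun h => ?_, hfin⟩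
  obtain ⟨x, hx⟩ := hv0
  exact hx (by rw [hfin x, h, zero_mul])

theorem mainTheorem7 (μ : ℝ → ℝ) (hμ : IsMassAspect μ)
    (I : Set ℝ) (hI : IsHalfClosedPeriodInterval I) :
    (∀ n : ℕ, (IsTypeH n μ ∨ ∃ q : ℝ, IsTypeP n q μ) →
      ∀ ψ : ℝ → ℝ, IsHillFunction μ ψ →
        numZeros ψ I + 1 = (n : ℕ∞) ∨ numZeros ψ I = (n : ℕ∞) ∨
          numZeros ψ I = (n : ℕ∞) + 1) ∧
    (∀ m : ℝ, IsTypeE m μ →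
      ∀ ψ : ℝ → ℝ, IsHillFunction μ ψ →
        (numZeros ψ I = (⌊Real.sqrt |m|⌋₊ : ℕ∞) ∨
          numZeros ψ I = (⌊Real.sqrt |m|⌋₊ : ℕ∞) + 1) ∧
        (∀ N : ℕ, Real.sqrt |m| = (N : ℝ) → numZeros ψ I = (N : ℕ∞))) ∧
    ((IsTypeHZero μ ∨ IsTypePZero μ) →
      ∀ ψ : ℝ → ℝ, IsHillFunction μ ψ →
        numZeros ψ I = 0 ∨ numZeros ψ I = 1) := by
  refine ⟨?_, ?_, ?_⟩
  · rintro n (⟨hn, σ, hσ, h⟩ | ⟨q, hn, hq, h⟩) ψ hψ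
    · obtain ⟨u', hu⟩ := exists_hillSolution_hyp hn hσ
      have hn0 : (n : ℝ) ≠ 0 := by exact_mod_cast (by omega : n ≠ 0)
      -- The shift by `π / n` turns the sine into `cos (n x / 2)`.
      refine h.numZeros_of_sin_factor (x₀ := -(Real.pi / n))
        (g := fun x => Real.exp (-(√σ / 2) * x) / √(hypF n σ x)) (u' := u') hn
        (continuous_hypMassAspect n σ) hψ hI
        (fun x => div_ne_zero (Real.exp_pos _).ne' (Real.sqrt_pos.2 (hypF_pos n σ x)).ne') ?_
      convert hu using 2 with x
      have : (n : ℝ) * (x - -(Real.pi / n)) / 2 = n * x / 2 + Real.pi / 2 := by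
        field_simp
        ring
      rw [this, Real.sin_add_pi_div_two]
      ring
    · obtain ⟨u', hu⟩ := exists_hillSolution_par n hq
      refine h.numZeros_of_sin_factor (x₀ := 0) (g := fun x => 1 / √(parJ n q x)) (u' := u') hn
        (continuous_parMassAspect n hq) hψ hI
        (fun x => div_ne_zero one_ne_zero (Real.sqrt_pos.2 (parJ_pos n hq x)).ne') ?_
      convert hu using 2 with x
      rw [sub_zero]
      ring
  · rintro m ⟨hm, h⟩ ψ hψ
    obtain ⟨φ, φ', J, hφ, hφ0, hJ, hz⟩ := h.exists_hillSolution hψ hI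
    have hk : 0 < √|m| := Real.sqrt_pos.2 (abs_pos.2 hm.ne)
    have hk2 : m = -√|m| ^ 2 := by
      rw [Real.sq_sqrt (abs_nonneg m), abs_of_neg hm, neg_neg]
    generalize √|m| = k at *
    subst hk2
    obtain ⟨R, x₀, hR, hφR⟩ := hφ.eq_sin hk hφ0
    obtain ⟨M, hM, hM1, hM2⟩ := exists_numZeros_sin hk x₀ hJ
    have hzM : numZeros ψ I = M := by
      rw [hz, ← hM]
      simp [numZeros, hφR, hR]
    rw [hzM]
    constructor
    · have h1 := Nat.floor_le hk.le
      have h2 := Nat.lt_floor_add_one k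
      have h3 : (M : ℝ) < ⌊k⌋₊ + 2 := by linarith
      have h4 : (⌊k⌋₊ : ℝ) < M + 1 := by linarith
      norm_cast at *
      omega
    · rintro N rfl
      norm_cast at *
      omega
  · rintro (⟨m, hm, h⟩ | h) ψ hψ
    · have he := hasDerivAt_exp_mul (√m / 2)
      refine h.numZeros_of_pos continuous_const hψ hI (fun x => Real.exp_pos (√m / 2 * x))
        ⟨he, fun x => ?_⟩
      refine ((he x).const_mul (√m / 2)).congr_deriv ?_
      linear_combination (Real.exp (√m / 2 * x) / 4) * Real.sq_sqrt hm.le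
    · refine h.numZeros_of_pos continuous_const hψ hI (u := fun _ => 1) (u' := fun _ => 0)
        (fun _ => one_pos) ⟨fun x => hasDerivAt_const x 1, fun x => ?_⟩
      simpa using hasDerivAt_const x (0 : ℝ)
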